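/- Let $\mathbb T=\mathbb R/\mathbb Z$ and let $e:\mathbb T\to\mathbb C$ be defined by $e(x+\mathbb Z)=\exp(2\pi i x)$ for $x\in\mathbb R$. A set $S\subseteq\mathbb Z$ is called a set of recurrence if for every probability space $(X,\mu)$, every invertible measure preserving transformation $T:X\to X$ (with measurable inverse) and every measurable $D\subseteq X$ with $\mu(D)>0$, there is an $n\in S$ such that $\mu(D\cap T^nD)>0$. The set $S$ is called measure expanding if for every $m\in\mathbb Z$ the translate $S+m=\{s+m:s\in S\}$ is a set of recurrence. A Borel measure $\sigma$ on $\mathbb T$ is called continuous if $\sigma(\{a\})=0$ for every $a\in\mathbb T$. Let $S\subseteq\mathbb Z$ be measure expanding. Then there are a sequence $(s_n')_{n\in\mathbb N}$ of elements of $S$ and continuous Borel probability measures $\sigma_m$ ($m\in\mathbb Z$) on $\mathbb T$ such that (i) $S':=\{s_n':n\in\mathbb N\}$ is measure expanding, and (ii) $\displaystyle\lim_{n\to\infty}\int_{\mathbb T}|e((s_n'-m)x)-1|\,d\sigma_m(x)=0$ for every $m\in\mathbb Z$. -/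

import Mathlib

open MeasureTheory Filter Topology

universe u v

/-- `S ⊆ ℤ` is a set of recurrence, tested on the probability measure preserving systems whose
underlying space lives in `Type u`. A system is a probability space `(X, μ)` with an invertible,
bi-measurable, measure preserving `T : X → X`; `T ^ n` (`n ∈ ℤ`) is the power of `T` in the group of
permutations of `X`, so `(T ^ n) '' D` is the image `Tⁿ D`, also for negative `n`. -/
def IsRecurrenceSet (S : Set ℤ) : Prop :=
  ∀ (X : Type u) [MeasurableSpace X] (μ : Measure X) [IsProbabilityMeasure μ] (T : X ≃ᵐ X),
    MeasurePreserving T μ μ → ∀ D : Set X, MeasurableSet D → 0 < μ D →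
      ∃ n ∈ S, 0 < μ (D ∩ ((T.toEquiv : Equiv.Perm X) ^ n) '' D)

/-- `S ⊆ ℤ` is measure expanding if each of its translates `S + m = {s + m : s ∈ S}` is a set of
recurrence. -/
def IsMeasureExpanding (S : Set ℤ) : Prop :=
  ∀ m : ℤ, IsRecurrenceSet.{u} ((fun s => s + m) '' S)

/-!
The sequence and the measures are built together, in stages. At stage `k` each `σ m` is approximated
by the uniform measure on `N` points of finite order in the circle, and a finite block of `S` is
chosen such that each `s` in the block satisfies `(s - m) • x = 0` for most of these points `x`,
whenever `|m| ≤ k`. The next stage splits every point into many points very close to it, so close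
that nothing gained so far is lost; the number of points grows and they stay separated, so the weak
limits `σ m` have no atoms (`Stage.exists_limit`, `Stage.limit_fibre_null`).

The blocks have to be recurrent enough for their union to be measure expanding: the translates by
`|m| ≤ k` of block `k` must return every set of measure at least `1 / (k + 1)`. Two facts make this
possible.

* `IsMeasureExpanding.isRecurrentAt_congr`: if the points at a stage have pairwise coprime orders
  `q i`, then the `s ∈ S` with `s ≡ t i` modulo most of the `q i` still have translates that return
  every set of measure at least `δ`, provided that there are enough moduli in terms of `δ` and of
  the allowed proportion of exceptions. For a fixed set of congruences this would fail, a rotation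
  with that period being an obstruction; the exceptions are what defeats it. By the Chinese
  remainder theorem, the times during which an orbit visits a set of measure `δ` form a set of
  density `δ` in `∏ i, ZMod (q i)`, and concentration of measure in the Hamming metric (Efron–Stein)
  puts its difference set near every point, which yields a return time `k` in the right residue
  classes. As `S` is measure expanding, `k` can be exchanged for an element of `S` in the same
  class modulo `∏ i, q i`.
* `IsRecurrentAt.exists_finite`: for sets of measure at least `δ`, finitely many return times
  suffice. This is compactness of the space of shift invariant measures on binary sequences.
-/

/-! ### Integer powers of a measure preserving transformation -/

section Powers

variable {X : Type*} [MeasurableSpace X] {μ : Measure X} {T : X ≃ᵐ X}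

theorem measurePreserving_zpow (hT : MeasurePreserving T μ μ) (n : ℤ) :
    MeasurePreserving (⇑((T.toEquiv : Equiv.Perm X) ^ n)) μ μ := by
  obtain ⟨k, rfl | rfl⟩ := n.eq_nat_or_neg
  · rw [zpow_natCast, Equiv.Perm.coe_pow]
    exact hT.iterate k
  · rw [zpow_neg, zpow_natCast, ← inv_pow, Equiv.Perm.coe_pow]
    exact (MeasurePreserving.symm T hT).iterate k

theorem zpow_image_eq_preimage (T : X ≃ᵐ X) (n : ℤ) (D : Set X) :
    ((T.toEquiv : Equiv.Perm X) ^ n) '' D = ((T.toEquiv : Equiv.Perm X) ^ (-n)) ⁻¹' D := by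
  rw [Equiv.image_eq_preimage_symm, zpow_neg]
  rfl

theorem measurableSet_zpow_image (hT : MeasurePreserving T μ μ) (n : ℤ) {D : Set X}
    (hD : MeasurableSet D) : MeasurableSet (((T.toEquiv : Equiv.Perm X) ^ n) '' D) := by
  rw [zpow_image_eq_preimage]
  exact (measurePreserving_zpow hT _).measurable hD

end Powers

/-- `S ⊆ ℤ` is recurrent at density `δ`: the recurrence property, for systems living in `Type u`,
restricted to sets of measure at least `δ`. -/
def IsRecurrentAt (S : Set ℤ) (δ : ENNReal) : Prop :=
  ∀ (X : Type u) [MeasurableSpace X] (μ : Measure X) [IsProbabilityMeasure μ] (T : X ≃ᵐ X),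
    MeasurePreserving T μ μ → ∀ D : Set X, MeasurableSet D → δ ≤ μ D →
      ∃ n ∈ S, 0 < μ (D ∩ ((T.toEquiv : Equiv.Perm X) ^ n) '' D)

theorem IsRecurrentAt.mono {S S' : Set ℤ} {δ : ENNReal} (h : IsRecurrentAt.{u} S δ)
    (hS : S ⊆ S') : IsRecurrentAt.{u} S' δ := fun X _ μ _ T hT D hD hμ =>
  let ⟨n, hn, h'⟩ := h X μ T hT D hD hμ
  ⟨n, hS hn, h'⟩

/-! ### Compactness: finitely many return times suffice at each density -/

/-- The left shift `y ↦ (i ↦ y (i + 1))` on two-sided binary sequences. -/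
def binaryShift : (ℤ → Bool) ≃ᵐ (ℤ → Bool) where
  toFun y i := y (i + 1)
  invFun y i := y (i - 1)
  left_inv y := by simp
  right_inv y := by simp
  measurable_toFun := by
    refine measurable_pi_lambda _ fun i => ?_
    exact measurable_pi_apply (i + 1)
  measurable_invFun := by
    refine measurable_pi_lambda _ fun i => ?_
    exact measurable_pi_apply (i - 1)

theorem binaryShift_zpow_apply (n : ℤ) (y : ℤ → Bool) (i : ℤ) :
    ((binaryShift.toEquiv : Equiv.Perm (ℤ → Bool)) ^ n) y i = y (i + n) := by
  induction n using Int.induction_on generalizing y with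
  | zero => simp
  | succ n ih =>
    rw [zpow_add_one, Equiv.Perm.mul_apply, ih]
    change y (i + n + 1) = _
    rw [add_assoc]
  | pred n ih =>
    rw [sub_eq_add_neg, zpow_add, Equiv.Perm.mul_apply, ih, zpow_neg_one]
    change y (i + -n - 1) = _
    congr 1
    ring

/-- Furstenberg's coding: a set `D` in a system induces a shift invariant measure on binary
sequences with the same return statistics, the coordinate at `0` playing the role of `D`. -/
theorem exists_shiftInvariant_coding {X : Type v} [MeasurableSpace X] (μ : Measure X)
    [IsProbabilityMeasure μ] (T : X ≃ᵐ X) (hT : MeasurePreserving T μ μ) {D : Set X}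
    (hD : MeasurableSet D) :
    ∃ ν : ProbabilityMeasure (ℤ → Bool), (ν : Measure (ℤ → Bool)).map binaryShift = ν ∧
      (ν : Measure (ℤ → Bool)) {y | y 0 = true} = μ D ∧
      ∀ n : ℤ, (ν : Measure (ℤ → Bool)) {y | y 0 = true ∧ y (-n) = true} =
        μ (D ∩ ((T.toEquiv : Equiv.Perm X) ^ n) '' D) := by
  classical
  let φ : X → ℤ → Bool := fun x i => decide (((T.toEquiv : Equiv.Perm X) ^ i) x ∈ D)
  have hφ : Measurable φ := by
    refine measurable_pi_lambda _ fun i => measurable_to_bool ?_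
    have : (fun c => φ c i) ⁻¹' {true} = ((T.toEquiv : Equiv.Perm X) ^ i) ⁻¹' D := by
      ext x; simp [φ]
    rw [this]
    exact (measurePreserving_zpow hT i).measurable hD
  have hcoord : ∀ i : ℤ, MeasurableSet {y : ℤ → Bool | y i = true} := fun i =>
    measurableSet_eq_fun (measurable_pi_apply i) measurable_const
  refine ⟨⟨μ.map φ, Measure.isProbabilityMeasure_map hφ.aemeasurable⟩, ?_, ?_, ?_⟩
  · change (μ.map φ).map binaryShift = μ.map φ
    have hcomp : binaryShift ∘ φ = φ ∘ T := by
      funext x i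
      change φ x (i + 1) = φ (T x) i
      simp only [φ, zpow_add_one, Equiv.Perm.mul_apply]
      rfl
    rw [Measure.map_map binaryShift.measurable hφ, hcomp,
      ← Measure.map_map hφ T.measurable, hT.map_eq]
  · change μ.map φ _ = _
    rw [Measure.map_apply hφ (hcoord 0)]
    congr 1
    ext x; simp [φ]
  · intro n
    have hm : MeasurableSet {y : ℤ → Bool | y 0 = true ∧ y (-n) = true} :=
      (hcoord 0).inter (hcoord (-n))
    change μ.map φ _ = _
    rw [Measure.map_apply hφ hm, zpow_image_eq_preimage]
    congr 1
    ext x; simp [φ]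

/-- If `S` is recurrent at density `δ`, then so is a finite subset of it. Otherwise the finite
sets `S ∩ [-k, k]` have counterexamples; a weak limit of their codings is a shift invariant measure
contradicting recurrence of `S`. The limit lives on binary sequences, hence the universe may
change. -/
theorem IsRecurrentAt.exists_finite {S : Set ℤ} {δ : ENNReal} (h : IsRecurrentAt.{u} S δ) :
    ∃ R : Finset ℤ, (R : Set ℤ) ⊆ S ∧ IsRecurrentAt.{v} (R : Set ℤ) δ := by
  classical
  by_contra! hcon
  let R : ℕ → Finset ℤ := fun k => (Finset.Icc (-k : ℤ) k).filter (· ∈ S)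
  have hν : ∀ k : ℕ, ∃ ν : ProbabilityMeasure (ℤ → Bool),
      (ν : Measure (ℤ → Bool)).map binaryShift = ν ∧
      δ ≤ (ν : Measure (ℤ → Bool)) {y | y 0 = true} ∧
      ∀ n ∈ R k, (ν : Measure (ℤ → Bool)) {y | y 0 = true ∧ y (-n) = true} = 0 := by
    intro k
    have := hcon (R k) (fun n hn => by simp [R] at hn; exact hn.2)
    unfold IsRecurrentAt at this
    push Not at this
    obtain ⟨X, _, μ, _, T, hT, D, hD, hδ, hn⟩ := this
    obtain ⟨ν, h1, h2, h3⟩ := exists_shiftInvariant_coding μ T hT hD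
    exact ⟨ν, h1, h2 ▸ hδ, fun n hnR => by rw [h3]; exact le_antisymm (hn n hnR) zero_le⟩
  choose ν hν1 hν2 hν3 using hν
  let U : Ultrafilter ℕ := hyperfilter ℕ
  obtain ⟨ν₀, -, hlim⟩ := isCompact_univ.ultrafilter_le_nhds (U.map ν) (by simp)
  have hlim : Tendsto ν U (𝓝 ν₀) := hlim
  have hU : (U : Filter ℕ) ≤ atTop := Nat.hyperfilter_le_atTop
  have hcl : ∀ i : ℤ, IsClopen {y : ℤ → Bool | y i = true} := fun i =>
    (isClopen_discrete {true}).preimage (continuous_apply i)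
  have hinv : (ν₀ : Measure (ℤ → Bool)).map binaryShift = ν₀ := by
    have hc : Continuous binaryShift := continuous_pi fun i => continuous_apply (i + 1)
    have h1 := (ProbabilityMeasure.continuous_map hc).continuousAt.tendsto.comp hlim
    have h2 : (fun ν : ProbabilityMeasure (ℤ → Bool) =>
        ν.map (hc.measurable.aemeasurable)) ∘ ν = ν := by
      funext k
      apply Subtype.ext
      exact hν1 k
    rw [h2] at h1
    have := tendsto_nhds_unique h1 hlim
    exact congrArg Subtype.val this
  have hδ : δ ≤ (ν₀ : Measure (ℤ → Bool)) {y | y 0 = true} :=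
    ge_of_tendsto (ProbabilityMeasure.tendsto_measure_of_null_frontier_of_tendsto' hlim
      (by simp [(hcl 0).frontier_eq])) (Eventually.of_forall hν2)
  have hzero : ∀ n ∈ S, (ν₀ : Measure (ℤ → Bool)) {y | y 0 = true ∧ y (-n) = true} = 0 := by
    intro n hn
    have h1 := ProbabilityMeasure.tendsto_measure_of_null_frontier_of_tendsto' hlim
      (E := {y | y 0 = true} ∩ {y | y (-n) = true})
      (by simp [((hcl 0).inter (hcl (-n))).frontier_eq])
    refine tendsto_nhds_unique_of_eventuallyEq h1 tendsto_const_nhds ?_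
    filter_upwards [hU (eventually_ge_atTop n.natAbs)] with k hk
    exact hν3 k n (by
      simp only [R, Finset.mem_filter, Finset.mem_Icc]
      exact ⟨by omega, hn⟩)
  -- The limit system, moved to `Type u`.
  let e : ULift.{u} (ℤ → Bool) ≃ᵐ (ℤ → Bool) := MeasurableEquiv.ulift
  have hmp : MeasurePreserving e.symm (ν₀ : Measure (ℤ → Bool))
      ((ν₀ : Measure (ℤ → Bool)).map e.symm) := e.symm.measurable.measurePreserving _
  have hmp' := MeasurePreserving.symm e.symm hmp
  let T : ULift.{u} (ℤ → Bool) ≃ᵐ ULift.{u} (ℤ → Bool) := (e.trans binaryShift).trans e.symm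
  have hT : MeasurePreserving T ((ν₀ : Measure (ℤ → Bool)).map e.symm)
      ((ν₀ : Measure (ℤ → Bool)).map e.symm) := by
    have hb : MeasurePreserving binaryShift (ν₀ : Measure (ℤ → Bool)) ν₀ :=
      ⟨binaryShift.measurable, hinv⟩
    exact hmp.comp (hb.comp hmp')
  have hTn : ∀ (n : ℤ) (x), e (((T.toEquiv : Equiv.Perm _) ^ n) x) =
      ((binaryShift.toEquiv : Equiv.Perm _) ^ n) (e x) := by
    intro n x
    have : (T.toEquiv : Equiv.Perm _) =
        e.toEquiv.symm.permCongrHom (binaryShift.toEquiv : Equiv.Perm _) := by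
      ext x; rfl
    rw [this, ← map_zpow]
    rfl
  have : IsProbabilityMeasure ((ν₀ : Measure (ℤ → Bool)).map e.symm) :=
    Measure.isProbabilityMeasure_map e.symm.measurable.aemeasurable
  obtain ⟨n, hn, hpos⟩ := h _ ((ν₀ : Measure (ℤ → Bool)).map e.symm) T hT
    (e ⁻¹' {y | y 0 = true}) (e.measurable (hcl 0).isOpen.measurableSet) (by
      rw [e.symm.map_apply]
      exact hδ)
  refine hpos.ne' ?_
  rw [zpow_image_eq_preimage, e.symm.map_apply]
  convert hzero n hn using 2
  ext y
  simp only [Set.preimage_ofPred_eq, Set.mem_preimage, Set.mem_inter_iff, Set.mem_ofPred_eq, hTn,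
    binaryShift_zpow_apply, zero_add, MeasurableEquiv.apply_symm_apply]

/-! ### The Efron–Stein inequality and concentration in finite products -/

theorem sum_sum_sub_sq {α : Type*} [Fintype α] (f : α → ℝ) :
    ∑ a, ∑ b, (f a - f b) ^ 2 = 2 * (Fintype.card α * ∑ a, f a ^ 2 - (∑ a, f a) ^ 2) := by
  have h : ∀ a b, (f a - f b) ^ 2 = f a ^ 2 + f b ^ 2 - 2 * (f a * f b) := fun a b => by ring
  simp only [h, Finset.sum_sub_distrib, Finset.sum_add_distrib, ← Finset.mul_sum,
    ← Finset.sum_mul, Finset.sum_const, Finset.card_univ, nsmul_eq_mul]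
  ring

theorem card_mul_sum_sq_sub_le {α : Type*} [Fintype α] {f : α → ℝ} {L : ℝ}
    (hf : ∀ a b, |f a - f b| ≤ L) :
    Fintype.card α * ∑ a, f a ^ 2 - (∑ a, f a) ^ 2 ≤ L ^ 2 * (Fintype.card α : ℝ) ^ 2 := by
  have h1 : ∑ a, ∑ b, (f a - f b) ^ 2 ≤ ∑ _a : α, ∑ _b : α, L ^ 2 := by
    refine Finset.sum_le_sum fun a _ => Finset.sum_le_sum fun b _ => ?_
    exact sq_le_sq' (neg_le_of_abs_le (hf a b)) (le_of_abs_le (hf a b))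
  rw [sum_sum_sub_sq] at h1
  simp only [Finset.sum_const, Finset.card_univ, nsmul_eq_mul] at h1
  nlinarith [mul_nonneg (sq_nonneg L) (sq_nonneg (Fintype.card α : ℝ))]

/-- Efron–Stein: the variance of a function on a product of `n` uniform finite spaces which moves by
at most `L` when one coordinate changes is at most `n * L ^ 2`. -/
theorem efronStein {n : ℕ} {G : Fin n → Type*} [∀ i, Fintype (G i)] (f : (∀ i, G i) → ℝ) {L : ℝ}
    (hf : ∀ i x (a : G i), |f (Function.update x i a) - f x| ≤ L) :
    Fintype.card (∀ i, G i) * ∑ x, f x ^ 2 - (∑ x, f x) ^ 2 ≤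
      n * L ^ 2 * (Fintype.card (∀ i, G i) : ℝ) ^ 2 := by
  induction n generalizing L with
  | zero => simp
  | succ n ih =>
    let e := Fin.consEquiv G
    have hcard : Fintype.card (∀ i, G i) =
        Fintype.card (G 0) * Fintype.card (∀ i : Fin n, G i.succ) := by
      rw [← Fintype.card_prod]
      exact Fintype.card_congr e.symm
    have hsum : ∀ g : (∀ i, G i) → ℝ, ∑ x, g x = ∑ y, ∑ a, g (Fin.cons a y) := by
      intro g
      rw [← e.sum_comp, Fintype.sum_prod_type_right]
      rfl
    rw [hsum, hsum, hcard]
    push_cast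
    set c := (Fintype.card (G 0) : ℝ)
    set c' := (Fintype.card (∀ i : Fin n, G i.succ) : ℝ)
    -- The variance in the coordinate `0`, the others being fixed.
    have h1 : ∀ y : ∀ i : Fin n, G i.succ,
        c * ∑ a, f (Fin.cons a y) ^ 2 - (∑ a, f (Fin.cons a y)) ^ 2 ≤ L ^ 2 * c ^ 2 := by
      intro y
      refine card_mul_sum_sq_sub_le fun a b => ?_
      have := hf 0 (Fin.cons b y) a
      rwa [Fin.update_cons_zero] at this
    -- The variance of the partial sum over the coordinate `0`.
    have h2 := ih (fun y : ∀ i : Fin n, G i.succ => ∑ a, f (Fin.cons a y)) (L := c * L) (by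
      intro i y b
      rw [← Finset.sum_sub_distrib]
      refine (Finset.abs_sum_le_sum_abs _ _).trans ?_
      refine (Finset.sum_le_card_nsmul _ _ L fun a _ => ?_).trans_eq (by simp [c])
      have := hf i.succ (Fin.cons a y) b
      rwa [← Fin.cons_update] at this)
    have h3 : ∑ y : ∀ i : Fin n, G i.succ,
        (c * ∑ a, f (Fin.cons a y) ^ 2 - (∑ a, f (Fin.cons a y)) ^ 2) ≤ c' * (L ^ 2 * c ^ 2) :=
      (Finset.sum_le_card_nsmul _ _ _ fun y _ => h1 y).trans_eq (by simp [c'])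
    rw [Finset.sum_sub_distrib, ← Finset.mul_sum] at h3
    have hc' : 0 ≤ c' := Nat.cast_nonneg _
    have h4 := mul_le_mul_of_nonneg_left h3 hc'
    calc _ = c' * (c * ∑ y, ∑ a, f (Fin.cons a y) ^ 2 - ∑ y, (∑ a, f (Fin.cons a y)) ^ 2)
          + (c' * ∑ y, (∑ a, f (Fin.cons a y)) ^ 2 - (∑ y, ∑ a, f (Fin.cons a y)) ^ 2) := by ring
      _ ≤ c' * (c' * (L ^ 2 * c ^ 2)) + n * (c * L) ^ 2 * c' ^ 2 := add_le_add h4 h2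
      _ = _ := by ring

/-- In a product of `n` finite groups, the difference set of a set of density `δ` comes within
Hamming distance `r` of every point as soon as `√(2 * n) < δ * r`. Otherwise
the Hamming distance to `A` would be at least `r` on `A + t` and zero on `A`, two sets of density
`δ`, which the Efron–Stein inequality forbids. -/
theorem exists_sub_near {n : ℕ} {G : Fin n → Type*} [∀ i, Fintype (G i)] [∀ i, DecidableEq (G i)]
    [∀ i, AddCommGroup (G i)] {A : Finset (∀ i, G i)} {δ : ℝ}
    (hA : δ * Fintype.card (∀ i, G i) ≤ A.card) (hδ : 0 < δ) {r : ℕ} (hr : 2 * n < (δ * r) ^ 2)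
    (t : ∀ i, G i) :
    ∃ a ∈ A, ∃ b ∈ A, (Finset.univ.filter fun i => a i - b i ≠ t i).card < r := by
  by_contra! hcon
  have hcard : (0 : ℝ) < Fintype.card (∀ i, G i) := by exact_mod_cast Fintype.card_pos
  have hne : A.Nonempty := by
    rw [← Finset.card_pos]
    exact_mod_cast (mul_pos hδ hcard).trans_le hA
  let d : (∀ i, G i) → ℕ := fun x => A.inf' hne (hammingDist x)
  have hd : ∀ x y, d x ≤ d y + hammingDist x y := by
    intro x y
    obtain ⟨a, ha, hay⟩ := A.exists_mem_eq_inf' hne (hammingDist y)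
    have h1 : d x ≤ hammingDist x a := Finset.inf'_le _ ha
    have h2 := hammingDist_triangle x y a
    have h3 : d y = hammingDist y a := hay
    omega
  have hup : ∀ i x (a : G i), hammingDist (Function.update x i a) x ≤ 1 := by
    intro i x a
    refine (Finset.card_le_card (t := {i}) fun j hj => ?_).trans (by simp)
    by_contra hji
    simp only [Finset.mem_singleton] at hji
    simp [Function.update_of_ne hji] at hj
  have hES := efronStein (fun x => (d x : ℝ)) (L := 1) (by
    intro i x a
    have h1 := hd (Function.update x i a) x
    have h2 := hd x (Function.update x i a)
    have h3 := hup i x a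
    rw [hammingDist_comm] at h2
    rw [abs_le]
    constructor
    · have : (d x : ℝ) ≤ d (Function.update x i a) + 1 := by exact_mod_cast (by omega)
      linarith
    · have : (d (Function.update x i a) : ℝ) ≤ d x + 1 := by exact_mod_cast (by omega)
      linarith)
  have hzero : ∀ a ∈ A, d a = 0 := fun a ha =>
    Nat.le_zero.1 ((Finset.inf'_le _ ha).trans (by simp))
  have hbig : ∀ b ∈ A, r ≤ d (b + t) := by
    intro b hb
    refine Finset.le_inf' _ _ fun a ha => (hcon a ha b hb).trans (Finset.card_le_card ?_)
    intro i hi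
    simp only [Finset.mem_filter, Finset.mem_univ, true_and, Pi.add_apply] at hi ⊢
    intro h
    exact hi (by rw [← h]; abel)
  have hlow : (A.card : ℝ) ^ 2 * r ^ 2 ≤ ∑ x, ∑ y, ((d x : ℝ) - d y) ^ 2 := by
    calc (A.card : ℝ) ^ 2 * r ^ 2 = ∑ _a ∈ A, ∑ _b ∈ A, (r : ℝ) ^ 2 := by
          simp only [Finset.sum_const, nsmul_eq_mul]; ring
      _ ≤ ∑ a ∈ A, ∑ b ∈ A, ((d a : ℝ) - d (b + t)) ^ 2 := by
          refine Finset.sum_le_sum fun a ha => Finset.sum_le_sum fun b hb => ?_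
          rw [hzero a ha, Nat.cast_zero, zero_sub, neg_sq]
          gcongr
          exact hbig b hb
      _ ≤ ∑ a ∈ A, ∑ b, ((d a : ℝ) - d (b + t)) ^ 2 := by
          gcongr with a ha
          exact Finset.subset_univ _
      _ = ∑ a ∈ A, ∑ b, ((d a : ℝ) - d b) ^ 2 :=
          Finset.sum_congr rfl fun a _ =>
            Equiv.sum_comp (Equiv.addRight t) fun b => ((d a : ℝ) - d b) ^ 2
      _ ≤ _ := by
          gcongr
          exact Finset.subset_univ _
  rw [sum_sum_sub_sq] at hlow
  have h1 : (δ * Fintype.card (∀ i, G i)) ^ 2 * r ^ 2 ≤ (A.card : ℝ) ^ 2 * r ^ 2 := by gcongr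
  have h2 := mul_lt_mul_of_pos_right hr (pow_pos hcard 2)
  linarith

/-! ### Return times in prescribed residue classes for most moduli -/

/-- A set of measure at least `δ` returns at some time `k` with `k ≡ t i` modulo all but fewer than
`r` of the moduli `q i`. Indeed, by the Chinese remainder theorem the times in a period form the
group `∏ i, ZMod (q i)`, some orbit visits the set on a subset of density at least `δ` of that group,
and `exists_sub_near` applies to it. -/
theorem exists_return_near {X : Type*} [MeasurableSpace X] {μ : Measure X} [IsProbabilityMeasure μ]
    {T : X ≃ᵐ X} (hT : MeasurePreserving T μ μ) {D : Set X} (hD : MeasurableSet D) {δ : ℝ}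
    (hδ : 0 < δ) (hμ : ENNReal.ofReal δ ≤ μ D) {n : ℕ} {q : Fin n → ℕ} [∀ i, NeZero (q i)]
    (hq : Pairwise (Function.onFun Nat.Coprime q)) (t : Fin n → ℤ) {r : ℕ}
    (hr : 2 * n < (δ * r) ^ 2) :
    ∃ k : ℤ, (Finset.univ.filter fun i => ¬ (q i : ℤ) ∣ k - t i).card < r ∧
      0 < μ (D ∩ ((T.toEquiv : Equiv.Perm X) ^ k) '' D) := by
  classical
  by_contra! hcon
  let c : (∀ i, ZMod (q i)) → ℤ := fun x => ((ZMod.prodEquivPi q hq).symm x).cast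
  have hc : ∀ x i, ((c x : ℤ) : ZMod (q i)) = x i := by
    intro x i
    have h1 : ((c x : ℤ) : ZMod (∏ i, q i)) = (ZMod.prodEquivPi q hq).symm x :=
      ZMod.intCast_zmod_cast _
    have h2 := congrFun (congrArg (ZMod.prodEquivPi q hq) h1) i
    rw [RingEquiv.apply_symm_apply] at h2
    rw [← h2, map_intCast]
    simp
  let E : (∀ i, ZMod (q i)) → Set X := fun x => ((T.toEquiv : Equiv.Perm X) ^ (c x)) ⁻¹' D
  have hE : ∀ x, MeasurableSet (E x) := fun x => (measurePreserving_zpow hT _).measurable hD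
  have hEμ : ∀ x, μ (E x) = μ D := fun x =>
    (measurePreserving_zpow hT _).measure_preimage hD.nullMeasurableSet
  have hnull : ∀ x y, (Finset.univ.filter fun i => x i - y i ≠ ((t i : ℤ) : ZMod (q i))).card < r →
      μ (E x ∩ E y) = 0 := by
    intro x y hxy
    have h1 : μ (D ∩ ((T.toEquiv : Equiv.Perm X) ^ (c x - c y)) '' D) = 0 := by
      refine le_antisymm (hcon _ ((Finset.card_le_card fun i hi => ?_).trans_lt hxy)) zero_le
      simp only [Finset.mem_filter, Finset.mem_univ, true_and] at hi ⊢
      contrapose! hi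
      rw [← ZMod.intCast_zmod_eq_zero_iff_dvd]
      push_cast
      rw [hc, hc, hi, sub_self]
    rw [← (measurePreserving_zpow hT (c x)).measure_preimage
      (hD.inter (measurableSet_zpow_image hT _ hD)).nullMeasurableSet] at h1
    refine measure_mono_null ?_ h1
    rintro ω ⟨hx, hy⟩
    refine ⟨hx, ?_⟩
    rw [zpow_image_eq_preimage, Set.mem_preimage, ← Equiv.Perm.mul_apply, ← zpow_add]
    have : -(c x - c y) + c x = c y := by ring
    rw [this]
    exact hy
  let N : Set X := ⋃ p : {p : (∀ i, ZMod (q i)) × (∀ i, ZMod (q i)) //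
    (Finset.univ.filter fun i => p.1 i - p.2 i ≠ ((t i : ℤ) : ZMod (q i))).card < r},
      E p.1.1 ∩ E p.1.2
  have hN : μ N = 0 := measure_iUnion_null fun p => hnull _ _ p.2
  let f : X → ENNReal := fun ω => ∑ x, (E x).indicator 1 ω
  have hf : Measurable f := Finset.measurable_fun_sum _ fun x _ =>
    measurable_one.indicator (hE x)
  have hint : ∫⁻ ω, f ω ∂μ = Fintype.card (∀ i, ZMod (q i)) * μ D := by
    rw [lintegral_finsetSum _ fun x _ => measurable_one.indicator (hE x)]
    simp only [lintegral_indicator_one (hE _), hEμ, Finset.sum_const, Finset.card_univ,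
      nsmul_eq_mul]
  obtain ⟨ω, hω, hle⟩ := exists_notMem_null_lintegral_le (μ := μ) (f := f) (by
    rw [hint]; exact ENNReal.mul_ne_top (ENNReal.natCast_ne_top _) (measure_ne_top _ _)) hN
  let A : Finset (∀ i, ZMod (q i)) := Finset.univ.filter fun x => ω ∈ E x
  have hfA : f ω = A.card := by
    simp only [f, A, Set.indicator_apply, Pi.one_apply, Finset.sum_boole]
  have hA : δ * Fintype.card (∀ i, ZMod (q i)) ≤ A.card := by
    have h1 : ENNReal.ofReal (δ * Fintype.card (∀ i, ZMod (q i))) ≤ ENNReal.ofReal A.card := by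
      rw [ENNReal.ofReal_mul hδ.le, ENNReal.ofReal_natCast, ENNReal.ofReal_natCast, ← hfA, mul_comm]
      refine le_trans ?_ hle
      rw [hint]
      gcongr
    exact (ENNReal.ofReal_le_ofReal_iff (Nat.cast_nonneg _)).1 h1
  obtain ⟨a, ha, b, hb, hab⟩ := exists_sub_near hA hδ hr fun i => ((t i : ℤ) : ZMod (q i))
  simp only [A, Finset.mem_filter, Finset.mem_univ, true_and] at ha hb
  exact hω (Set.mem_iUnion.2 ⟨⟨(a, b), hab⟩, ha, hb⟩)

/-- Intersecting a set of recurrence with `Q ℤ` gives a set of recurrence: test it on the product of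
a given system with the rotation of `ZMod Q`. -/
theorem IsRecurrenceSet.inter_dvd {R : Set ℤ} (hR : IsRecurrenceSet.{u} R) (Q : ℕ) [NeZero Q] :
    IsRecurrenceSet.{u} {n ∈ R | (Q : ℤ) ∣ n} := by
  intro X _ μ _ T hT D hD hμ
  let rot : ZMod Q ≃ᵐ ZMod Q :=
    ⟨Equiv.addRight 1, measurable_of_countable _, measurable_of_countable _⟩
  let ν : Measure (ZMod Q) := (Q : ENNReal)⁻¹ • Measure.count
  have hQ0 : (Q : ENNReal) ≠ 0 := by exact_mod_cast NeZero.ne Q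
  have hν : IsProbabilityMeasure ν := ⟨by
    simp only [ν, Measure.smul_apply, Measure.count_apply_finite _ Set.finite_univ, smul_eq_mul]
    simp [ZMod.card, ENNReal.inv_mul_cancel hQ0]⟩
  have hrot : MeasurePreserving rot ν ν := by
    refine MeasurePreserving.smul_measure ⟨rot.measurable, ?_⟩ _
    ext s hs
    rw [rot.map_apply, Measure.count_apply (rot.measurable hs), Measure.count_apply hs]
    congr 1
    exact Set.encard_preimage_of_bijective rot.bijective s
  let P : X × ZMod Q ≃ᵐ X × ZMod Q := T.prodCongr rot
  have hP : MeasurePreserving P (μ.prod ν) (μ.prod ν) := hT.prod hrot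
  have hPn : ∀ (n : ℤ) (x : X) (z : ZMod Q), ((P.toEquiv : Equiv.Perm _) ^ n) (x, z) =
      (((T.toEquiv : Equiv.Perm _) ^ n) x, z + n) := by
    intro n
    induction n using Int.induction_on with
    | zero => simp
    | succ n ih =>
      intro x z
      rw [zpow_add_one, zpow_add_one, Equiv.Perm.mul_apply, Equiv.Perm.mul_apply]
      refine (ih (T x) (z + 1)).trans ?_
      ext
      · rfl
      · push_cast; ring
    | pred n ih =>
      intro x z
      rw [zpow_sub_one, zpow_sub_one, Equiv.Perm.mul_apply, Equiv.Perm.mul_apply]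
      refine (ih (T.symm x) (z + -1)).trans ?_
      ext
      · rfl
      · push_cast; ring
  have hνz : ν {0} = (Q : ENNReal)⁻¹ := by
    simp [ν]
  obtain ⟨n, hn, hpos⟩ := hR _ (μ.prod ν) P hP (D ×ˢ {0}) (hD.prod (measurableSet_singleton 0)) (by
    rw [Measure.prod_prod, hνz]
    exact ENNReal.mul_pos hμ.ne' (by simp))
  rw [zpow_image_eq_preimage] at hpos
  obtain ⟨⟨x, z⟩, hx⟩ := nonempty_of_measure_ne_zero hpos.ne'
  have hQn : (Q : ℤ) ∣ n := by
    simp only [Set.mem_inter_iff, Set.mem_prod, Set.mem_singleton_iff, Set.mem_preimage, hPn] at hx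
    have h2 := hx.2.2
    rw [hx.1.2, zero_add, ZMod.intCast_zmod_eq_zero_iff_dvd] at h2
    exact (dvd_neg).1 h2
  refine ⟨n, ⟨hn, hQn⟩, pos_iff_ne_zero.2 fun h0 => hpos.ne' ?_⟩
  refine measure_mono_null (t := (D ∩ ((T.toEquiv : Equiv.Perm X) ^ n) '' D) ×ˢ {0}) ?_ ?_
  · rintro ⟨y, w⟩ hy
    rw [zpow_image_eq_preimage]
    simp only [Set.mem_inter_iff, Set.mem_prod, Set.mem_singleton_iff, Set.mem_preimage, hPn] at hy ⊢
    exact ⟨⟨hy.1.1, hy.2.1⟩, hy.1.2⟩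
  · rw [Measure.prod_prod, h0, zero_mul]

/-- In a measure expanding set, the elements congruent to `t i` modulo all but fewer than `r` of the
moduli `q i` still form a set all of whose translates are recurrent at density `δ`. With `k` from
`exists_return_near` and `G = D ∩ T ^ k D`, an `s ∈ S` in the class of `k - m` modulo `∏ i, q i`
with `μ (G ∩ T ^ (s + m - k) G) > 0` will do. -/
theorem IsMeasureExpanding.isRecurrentAt_congr {S : Set ℤ} (hS : IsMeasureExpanding.{u} S) {δ : ℝ}
    (hδ : 0 < δ) {n : ℕ} {q : Fin n → ℕ} [∀ i, NeZero (q i)]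
    (hq : Pairwise (Function.onFun Nat.Coprime q)) (t : Fin n → ℤ) {r : ℕ}
    (hr : 2 * n < (δ * r) ^ 2) (m : ℤ) :
    IsRecurrentAt.{u} ((fun s => s + m) ''
      {s ∈ S | (Finset.univ.filter fun i => ¬ (q i : ℤ) ∣ s - t i).card < r})
      (ENNReal.ofReal δ) := by
  intro X _ μ _ T hT D hD hμ
  obtain ⟨k, hk, hpos⟩ := exists_return_near hT hD hδ hμ hq (fun i => t i + m) hr
  set P : Equiv.Perm X := T.toEquiv with hP
  have : NeZero (∏ i, q i) := ⟨Finset.prod_ne_zero_iff.2 fun i _ => NeZero.ne _⟩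
  obtain ⟨_, ⟨⟨s, hs, rfl⟩, hdvd⟩, hpos'⟩ := (hS (m - k)).inter_dvd (∏ i, q i) X μ T hT
    (D ∩ (P ^ k) '' D) (hD.inter (measurableSet_zpow_image hT _ hD)) hpos
  refine ⟨s + m, ⟨s, ⟨hs, (Finset.card_le_card fun i hi => ?_).trans_lt hk⟩, rfl⟩,
    hpos'.trans_le (measure_mono ?_)⟩
  · simp only [Finset.mem_filter, Finset.mem_univ, true_and] at hi ⊢
    contrapose! hi
    have h1 : (q i : ℤ) ∣ s + (m - k) :=
      (Int.natCast_dvd_natCast.2 (Finset.dvd_prod_of_mem q (Finset.mem_univ i))).trans hdvd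
    have h2 := h1.add hi
    rwa [show s + (m - k) + (k - (t i + m)) = s - t i by ring] at h2
  · rintro x ⟨⟨hx, -⟩, y, ⟨-, z, hz, rfl⟩, rfl⟩
    refine ⟨hx, z, hz, ?_⟩
    rw [← Equiv.Perm.mul_apply, ← hP, ← zpow_add]
    congr 2
    ring

/-- `IsMeasureExpanding.isRecurrentAt_congr` for moduli indexed by any finite type. -/
theorem IsMeasureExpanding.isRecurrentAt_congr_fintype {S : Set ℤ}
    (hS : IsMeasureExpanding.{u} S) {δ : ℝ} (hδ : 0 < δ) {ι : Type*} [Fintype ι] {q : ι → ℕ}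
    (hq0 : ∀ i, q i ≠ 0) (hq : Pairwise (Function.onFun Nat.Coprime q)) (t : ι → ℤ) {r : ℕ}
    (hr : 2 * Fintype.card ι < (δ * r) ^ 2) (m : ℤ) :
    IsRecurrentAt.{u} ((fun s => s + m) ''
      {s ∈ S | (Finset.univ.filter fun i => ¬ (q i : ℤ) ∣ s - t i).card < r})
      (ENNReal.ofReal δ) := by
  classical
  let e := (Fintype.equivFin ι).symm
  have : ∀ i, NeZero ((q ∘ e) i) := fun i => ⟨hq0 _⟩
  have h := hS.isRecurrentAt_congr hδ (q := q ∘ e) (fun i j hij => hq (e.injective.ne hij))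
    (t ∘ e) hr m
  convert h using 5 with s
  rw [Finset.card_equiv e.symm]
  simp

/-! ### Points of coprime orders on the circle -/

theorem exists_addOrderOf_eq_prime_dist_le (z : UnitAddCircle) {p : ℕ} (hp : p.Prime) :
    ∃ y : UnitAddCircle, addOrderOf y = p ∧ dist y z ≤ 1 / p := by
  obtain ⟨x, rfl⟩ := QuotientAddGroup.mk_surjective z
  have hp0 : (0 : ℝ) < p := by exact_mod_cast hp.pos
  have key : ∀ a : ℤ, ¬ (p : ℤ) ∣ a → |a - x * p| ≤ 1 →
      ∃ y : UnitAddCircle, addOrderOf y = p ∧ dist y (x : UnitAddCircle) ≤ 1 / p := by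
    intro a ha hax
    refine ⟨((a / p : ℝ) : UnitAddCircle), ?_, ?_⟩
    · have hg : a.natAbs.gcd p = 1 := by
        rw [← Nat.coprime_iff_gcd_eq_one, Nat.coprime_comm, hp.coprime_iff_not_dvd]
        rwa [← Int.natCast_dvd]
      have := AddCircle.addOrderOf_div_of_gcd_eq_one' (p := (1 : ℝ)) hp.pos hg
      rwa [mul_one] at this
    · rw [dist_eq_norm, ← AddCircle.coe_sub]
      refine (QuotientAddGroup.norm_mk_le_norm).trans ?_
      rw [Real.norm_eq_abs, div_sub' hp0.ne', abs_div, abs_of_pos hp0, mul_comm (p : ℝ)]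
      gcongr
  have h1 := Int.floor_le (x * p)
  have h2 := Int.lt_floor_add_one (x * p)
  by_cases hd : (p : ℤ) ∣ ⌊x * p⌋
  · refine key (⌊x * p⌋ + 1) (fun h => ?_) ?_
    · have h3 : (p : ℤ) ∣ 1 := (dvd_add_right hd).1 h
      exact hp.one_lt.ne' (by exact_mod_cast Int.eq_one_of_dvd_one (by positivity) h3)
    · push_cast
      rw [abs_le]
      constructor <;> linarith
  · refine key _ hd ?_
    rw [abs_le]
    constructor <;> linarith

/-- Finitely many points of the circle can be moved slightly so that their orders become pairwise
coprime. -/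
theorem exists_pairwise_coprime_addOrderOf {ι : Type*} [Fintype ι] (z : ι → UnitAddCircle) {η : ℝ}
    (hη : 0 < η) :
    ∃ y : ι → UnitAddCircle, (∀ i, addOrderOf (y i) ≠ 0) ∧
      Pairwise (Function.onFun Nat.Coprime fun i => addOrderOf (y i)) ∧ Function.Injective y ∧
      ∀ i, dist (y i) (z i) ≤ η := by
  obtain ⟨K, hK⟩ := exists_nat_one_div_lt hη
  let q : ι → ℕ := fun i => Nat.nth Nat.Prime (K + Fintype.equivFin ι i)
  have hq : ∀ i, (q i).Prime := fun i => Nat.prime_nth_prime _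
  have hinj : Function.Injective q := fun i j hij => by
    have := Nat.nth_injective Nat.infinite_setOfPred_prime hij
    exact (Fintype.equivFin ι).injective (Fin.ext (by omega))
  choose y hy1 hy2 using fun i => exists_addOrderOf_eq_prime_dist_le (z i) (hq i)
  refine ⟨y, fun i => ?_, fun i j hij => ?_, fun i j hij => ?_, fun i => (hy2 i).trans ?_⟩
  · rw [hy1]; exact (hq i).ne_zero
  · simp only [Function.onFun, hy1]
    exact (Nat.coprime_primes (hq i) (hq j)).2 (hinj.ne hij)
  · exact hinj (by rw [← hy1, ← hy1, hij])
  · refine le_trans ?_ hK.le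
    gcongr
    have : K + Fintype.equivFin ι i + 2 ≤ q i := Nat.add_two_le_nth_prime _
    exact_mod_cast (by omega : K + 1 ≤ q i)

/-! ### One step of the construction -/

/-- A finite stage of the construction: for each `m`, the points `F m 0, …, F m (N - 1)` carry
masses `1 / N` each and approximate the measure `σ m`; `R` is the block of return times chosen at
this stage, and `e` the distance by which points may move at the next stage. -/
structure Stage where
  N : ℕ
  F : ℤ → ℕ → UnitAddCircle
  R : Finset ℤ
  e : ℝ

/-- What stage `k` achieves: the translates of its block `R` by `|m| ≤ k` are recurrent at density
`1 / (k + 1)`; for `s ∈ R` the character `s - m` is trivial at all but a proportion `1 / (k + 1)` of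
the points `F m j`, and stays close to `1` within `2 * e` of them; and these points are more than
`4 * e` apart. -/
structure Stage.IsGood (S : Set ℤ) (k : ℕ) (st : Stage) : Prop where
  lt_N : k < st.N
  subset : (st.R : Set ℤ) ⊆ S
  separated : ∀ m ∈ Finset.Icc (-k : ℤ) k, ∀ i ∈ Finset.range st.N, ∀ j ∈ Finset.range st.N,
    i ≠ j → 4 * st.e < dist (st.F m i) (st.F m j)
  card_le : ∀ m ∈ Finset.Icc (-k : ℤ) k, ∀ s ∈ st.R,
    ((Finset.range st.N).filter fun j => (s - m) • st.F m j ≠ 0).card * (k + 1) ≤ st.N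
  recurrent : ∀ m ∈ Finset.Icc (-k : ℤ) k,
    IsRecurrentAt.{v} ((fun s => s + m) '' (st.R : Set ℤ)) (ENNReal.ofReal (1 / (k + 1)))
  near : ∀ m ∈ Finset.Icc (-k : ℤ) k, ∀ s ∈ st.R, ∀ x : UnitAddCircle, ‖x‖ ≤ 2 * st.e →
    ‖(AddCircle.toCircle ((s - m) • x) : ℂ) - 1‖ ≤ 1 / (k + 1)

/-- The stage `st'` refines `st`: each point of `st` is replaced by `d` points within distance
`st.e` of it. -/
structure Stage.Refines (st st' : Stage) : Prop where
  e_pos : 0 < st'.e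
  e_le : st'.e ≤ st.e / 2
  N_pos : 0 < st'.N
  exists_mul : ∃ d, 0 < d ∧ st'.N = st.N * d ∧
    ∀ m, ∀ j < st'.N, dist (st'.F m j) (st.F m (j / d)) ≤ st.e

theorem eventually_mul_lt {c : ℝ} (a : ℝ) (hc : 0 < c) : ∀ᶠ e in 𝓝[>] (0 : ℝ), a * e < c := by
  have h : Tendsto (fun e : ℝ => a * e) (𝓝 0) (𝓝 (a * 0)) := tendsto_id.const_mul a
  rw [mul_zero] at h
  exact (h.eventually_lt_const hc).filter_mono nhdsWithin_le_nhds

theorem eventually_norm_toCircle_zsmul_sub_one_le (n : ℤ) {c : ℝ} (hc : 0 < c) :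
    ∀ᶠ e in 𝓝[>] (0 : ℝ), ∀ x : UnitAddCircle, ‖x‖ ≤ 2 * e →
      ‖(AddCircle.toCircle (n • x) : ℂ) - 1‖ ≤ c := by
  have hcont : Continuous fun x : UnitAddCircle => ‖(AddCircle.toCircle (n • x) : ℂ) - 1‖ :=
    ((continuous_subtype_val.comp
      (AddCircle.continuous_toCircle.comp (continuous_zsmul n))).sub continuous_const).norm
  have h := hcont.tendsto 0
  simp only [smul_zero, AddCircle.toCircle_zero, Circle.coe_one, sub_self, norm_zero] at h
  obtain ⟨ρ, hρ, hball⟩ := Metric.eventually_nhds_iff.1 (h.eventually_lt_const hc)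
  filter_upwards [eventually_mul_lt 2 hρ] with e he x hx
  exact (hball (by rw [dist_zero_right]; linarith)).le

/-- The inductive step. Each point of the stage is replaced by many nearby points, all of pairwise
coprime orders. By `IsMeasureExpanding.isRecurrentAt_congr` the `s ∈ S` that are congruent to `m`
modulo the order of `F m j`, for most `(m, j)`, still have recurrent translates, and
`IsRecurrentAt.exists_finite` extracts a finite block from them. -/
theorem Stage.exists_refines_isGood {S : Set ℤ} (hS : IsMeasureExpanding.{u} S) (k : ℕ) (st : Stage)
    (hN : 0 < st.N) (he : 0 < st.e) : ∃ st', st.Refines st' ∧ Stage.IsGood.{v} S k st' := by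
  classical
  let I := Finset.Icc (-k : ℤ) k
  -- There are `N'` points for each `m`, and fewer than `r = N' / (k + 1)` exceptions in all. The
  -- powers of `k + 1` make `r` large enough for `hr` below, where the density is `1 / (k + 1)` and
  -- the number of moduli is `(2 * k + 1) * N'`.
  let r : ℕ := st.N * (4 * (k + 1) ^ 4)
  let d : ℕ := 4 * (k + 1) ^ 5
  let N' : ℕ := st.N * d
  have hd : 0 < d := by positivity
  have hN' : N' = r * (k + 1) := by simp only [N', r, d]; ring
  have hkN : k < N' := by
    have : 0 < r := by positivity
    rw [hN']
    nlinarith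
  let ι := I × Fin N'
  have hcardI : Fintype.card I = 2 * k + 1 := by
    simp only [I, Fintype.card_coe, Int.card_Icc]
    omega
  have hδ : (0 : ℝ) < 1 / (k + 1) := by positivity
  have hr : 2 * (Fintype.card ι : ℝ) < (1 / (k + 1) * r) ^ 2 := by
    have h1 : (Fintype.card ι : ℝ) = (2 * k + 1) * (r * (k + 1)) := by
      have : Fintype.card ι = (2 * k + 1) * (r * (k + 1)) := by
        rw [Fintype.card_prod, hcardI, Fintype.card_fin, hN']
      exact_mod_cast this
    have h2 : (4 : ℝ) * (k + 1) ^ 4 ≤ r := by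
      have : 4 * (k + 1) ^ 4 ≤ r := Nat.le_mul_of_pos_left _ hN
      exact_mod_cast this
    have hr0 : (0 : ℝ) < r := lt_of_lt_of_le (by positivity) h2
    rw [h1, mul_pow, div_pow, one_pow, one_div, ← div_eq_inv_mul, lt_div_iff₀ (by positivity)]
    calc 2 * ((2 * (k : ℝ) + 1) * ((r : ℝ) * (k + 1))) * ((k : ℝ) + 1) ^ 2
        = (2 * (2 * (k : ℝ) + 1) * (k + 1) ^ 3) * r := by ring
      _ < (4 * ((k : ℝ) + 1) ^ 4) * r := by
          refine mul_lt_mul_of_pos_right ?_ hr0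
          have : (0 : ℝ) < ((k : ℝ) + 1) ^ 3 := by positivity
          nlinarith
      _ ≤ (r : ℝ) * r := by gcongr
      _ = (r : ℝ) ^ 2 := by ring
  obtain ⟨y, hy0, hyc, hyinj, hyd⟩ :=
    exists_pairwise_coprime_addOrderOf (fun i : ι => st.F i.1 ((i.2 : ℕ) / d)) he
  let F' : ℤ → ℕ → UnitAddCircle := fun m j =>
    if h : m ∈ I ∧ j < N' then y (⟨m, h.1⟩, ⟨j, h.2⟩) else st.F m (j / d)
  have hF' : ∀ (m : I) (j : Fin N'), F' m j = y (m, j) := fun m j => by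
    simp only [F']
    rw [dif_pos ⟨m.2, j.2⟩]
  have hFd : ∀ m, ∀ j < N', dist (F' m j) (st.F m (j / d)) ≤ st.e := by
    intro m j hj
    by_cases hm : m ∈ I
    · rw [hF' ⟨m, hm⟩ ⟨j, hj⟩]
      exact hyd _
    · simp only [F']
      rw [dif_neg fun h => hm h.1, dist_self]
      exact he.le
  -- For each `m`, a finite set of return times for the translate by `m`.
  have hfin := fun m : ℤ => (hS.isRecurrentAt_congr_fintype hδ hy0 hyc (fun i : ι => (i.1 : ℤ)) hr
    m).exists_finite
  choose R hRS hR using hfin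
  let R' : Finset ℤ := I.biUnion fun m => (R m).image (· - m)
  have hR' : ∀ s ∈ R', s ∈ S ∧
      (Finset.univ.filter fun i : ι => ¬ (addOrderOf (y i) : ℤ) ∣ s - i.1).card < r := by
    intro s hs
    simp only [R', Finset.mem_biUnion, Finset.mem_image] at hs
    obtain ⟨m, -, a, ha, rfl⟩ := hs
    obtain ⟨s, hs, rfl⟩ := hRS m ha
    simpa using hs
  have hsep : ∀ᶠ e in 𝓝[>] (0 : ℝ), ∀ m ∈ I, ∀ i ∈ Finset.range N', ∀ j ∈ Finset.range N',
      i ≠ j → 4 * e < dist (F' m i) (F' m j) := by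
    simp only [Finset.eventually_all]
    intro m hm i hi j hj
    rw [eventually_imp_distrib_left]
    intro hij
    refine eventually_mul_lt 4 (dist_pos.2 ?_)
    rw [hF' ⟨m, hm⟩ ⟨i, Finset.mem_range.1 hi⟩, hF' ⟨m, hm⟩ ⟨j, Finset.mem_range.1 hj⟩]
    exact hyinj.ne fun h => hij (congrArg (fun p : ι => (p.2 : ℕ)) h)
  have hnear : ∀ᶠ e in 𝓝[>] (0 : ℝ), ∀ m ∈ I, ∀ s ∈ R', ∀ x : UnitAddCircle, ‖x‖ ≤ 2 * e →
      ‖(AddCircle.toCircle ((s - m) • x) : ℂ) - 1‖ ≤ 1 / (k + 1) := by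
    simp only [Finset.eventually_all]
    intro m _ s _
    exact eventually_norm_toCircle_zsmul_sub_one_le _ hδ
  obtain ⟨e', he1, he2, he3, he4⟩ :=
    (hsep.and (hnear.and ((eventually_mul_lt 1 (half_pos he)).and self_mem_nhdsWithin))).exists
  refine ⟨⟨N', F', R', e'⟩, ⟨he4, by linarith, Nat.mul_pos hN hd, d, hd, rfl, hFd⟩,
    ⟨hkN, fun s hs => (hR' s hs).1, he1, fun m hm s hs => ?_, fun m hm => (hR m).mono ?_, he2⟩⟩
  · refine (Nat.mul_le_mul_right (k + 1) ?_).trans_eq hN'.symm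
    refine le_trans ?_ (hR' s hs).2.le
    refine Finset.card_le_card_of_injOn
      (fun j => if h : j < N' then (⟨m, hm⟩, ⟨j, h⟩) else (⟨m, hm⟩, ⟨0, by omega⟩)) ?_ ?_
    · intro j hj
      simp only [Finset.coe_filter, Finset.mem_range, Set.mem_ofPred_eq] at hj
      simp only [Finset.coe_filter, Finset.mem_univ, true_and, Set.mem_ofPred_eq, dif_pos hj.1]
      rw [addOrderOf_dvd_iff_zsmul_eq_zero, ← hF']
      exact hj.2
    · intro i hi j hj hij
      simp only [Finset.coe_filter, Finset.mem_range, Set.mem_ofPred_eq] at hi hj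
      simp only [dif_pos hi.1, dif_pos hj.1] at hij
      exact congrArg (fun p : ι => (p.2 : ℕ)) hij
  · intro n hn
    refine ⟨n - m, ?_, by ring⟩
    simp only [R', Finset.coe_biUnion, Set.mem_iUnion, Finset.coe_image]
    exact ⟨m, hm, n, hn, rfl⟩

/-! ### The limit measures -/

theorem measurable_step (N : ℕ) (F : ℕ → UnitAddCircle) :
    Measurable fun ω : ℝ => F ⌊N * Int.fract ω⌋₊ :=
  (measurable_from_top (f := F)).comp
    (Nat.measurable_floor.comp (measurable_fract.const_mul _))

theorem floor_mul_fract_lt {N : ℕ} (hN : 0 < N) (ω : ℝ) : ⌊N * Int.fract ω⌋₊ < N := by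
  have hN' : (0 : ℝ) < N := by exact_mod_cast hN
  rw [Nat.floor_lt (mul_nonneg hN'.le (Int.fract_nonneg ω))]
  have := Int.fract_lt_one ω
  nlinarith

theorem volume_floor_mul_fract_eq_le {N : ℕ} (hN : 0 < N) (j : ℕ) :
    (volume.restrict (Set.Ico (0 : ℝ) 1)) {ω | ⌊N * Int.fract ω⌋₊ = j} ≤
      ENNReal.ofReal (1 / N) := by
  have hN' : (0 : ℝ) < N := by exact_mod_cast hN
  rw [Measure.restrict_apply' measurableSet_Ico]
  refine (measure_mono (t := Set.Ico ((j : ℝ) / N) ((j + 1) / N)) ?_).trans_eq ?_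
  · rintro ω ⟨hω, hω1⟩
    change ⌊N * Int.fract ω⌋₊ = j at hω
    rw [Int.fract_eq_self.2 hω1, Nat.floor_eq_iff (mul_nonneg hN'.le hω1.1)] at hω
    constructor
    · rw [div_le_iff₀ hN']; linarith
    · rw [lt_div_iff₀ hN']; linarith
  · rw [Real.volume_Ico]
    congr 1
    ring

theorem volume_floor_mul_fract_mem_le {N : ℕ} (hN : 0 < N) (J : Finset ℕ) :
    (volume.restrict (Set.Ico (0 : ℝ) 1)) {ω | ⌊N * Int.fract ω⌋₊ ∈ J} ≤
      ENNReal.ofReal (J.card / N) := by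
  have h : {ω : ℝ | ⌊N * Int.fract ω⌋₊ ∈ J} = ⋃ j ∈ J, {ω : ℝ | ⌊N * Int.fract ω⌋₊ = j} := by
    ext ω; simp
  rw [h]
  refine (measure_biUnion_finset_le _ _).trans
    ((Finset.sum_le_card_nsmul _ _ _ fun j _ => volume_floor_mul_fract_eq_le hN j).trans_eq ?_)
  rw [nsmul_eq_mul, ← ENNReal.ofReal_natCast, ← ENNReal.ofReal_mul (Nat.cast_nonneg _), mul_one_div]

/-- Along refining stages, the step functions on `[0, 1)` (extended by periodicity) with the values
`F m 0, …, F m (N - 1)` converge uniformly. The measure `σ m` is the law of their limit. -/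
theorem Stage.exists_limit {st : ℕ → Stage} (hst : ∀ k, (st k).Refines (st (k + 1))) (m : ℤ) :
    ∃ X : ℝ → UnitAddCircle, Measurable X ∧ ∀ k ω,
      dist (X ω) ((st (k + 1)).F m ⌊(st (k + 1)).N * Int.fract ω⌋₊) ≤ 2 * (st (k + 1)).e := by
  let Y : ℕ → ℝ → UnitAddCircle := fun k ω => (st (k + 1)).F m ⌊(st (k + 1)).N * Int.fract ω⌋₊
  have hY : ∀ k ω, dist (Y k ω) (Y (k + 1) ω) ≤ (st (k + 1)).e := by
    intro k ω
    obtain ⟨d, hd, hN, hF⟩ := (hst (k + 1)).exists_mul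
    have hd' : (d : ℝ) ≠ 0 := by exact_mod_cast hd.ne'
    have h1 := hF m _ (floor_mul_fract_lt (hst (k + 1)).N_pos ω)
    rw [dist_comm] at h1
    convert h1 using 4
    rw [← Nat.floor_div_natCast, hN]
    congr 1
    push_cast
    field_simp
  have he : ∀ k n, (st (k + 1 + n)).e ≤ (st (k + 1)).e / 2 ^ n := by
    intro k n
    induction n with
    | zero => simp
    | succ n ih =>
      refine (hst (k + 1 + n)).e_le.trans ?_
      rw [pow_succ, ← div_div]
      gcongr
  have hgeo : ∀ k ω n, dist (Y (k + n) ω) (Y (k + (n + 1)) ω) ≤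
      2 * (st (k + 1)).e / 2 / 2 ^ n := by
    intro k ω n
    refine (hY (k + n) ω).trans ?_
    have h := he k n
    rw [mul_div_cancel_left₀ _ two_ne_zero]
    rwa [add_right_comm] at h
  have hlim : ∀ ω, ∃ x, Tendsto (fun n => Y n ω) atTop (𝓝 x) := fun ω =>
    cauchySeq_tendsto_of_complete (cauchySeq_of_le_geometric_two (C := 2 * (st 1).e) fun n => by
      simpa using hgeo 0 ω n)
  choose X hX using hlim
  refine ⟨X, measurable_of_tendsto_metrizable (fun n => measurable_step _ _)
    (tendsto_pi_nhds.2 hX), fun k ω => ?_⟩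
  have h := dist_le_of_le_geometric_two_of_tendsto₀ (f := fun n => Y (k + n) ω) (hgeo k ω)
    (((hX ω).comp (tendsto_add_atTop_nat k)).congr fun n => by
      simp only [Function.comp, add_comm])
  rw [dist_comm]
  exact h

/-- Points of good stages are separated by more than four times the remaining movement, so that a
fibre of the limit lies in a fibre of each step function, which has measure at most `1 / N`. -/
theorem Stage.limit_fibre_null {S : Set ℤ} {st : ℕ → Stage}
    (hgood : ∀ k, Stage.IsGood.{v} S k (st (k + 1))) {m : ℤ} {X : ℝ → UnitAddCircle}
    (hX : ∀ k ω, dist (X ω) ((st (k + 1)).F m ⌊(st (k + 1)).N * Int.fract ω⌋₊) ≤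
      2 * (st (k + 1)).e) (a : UnitAddCircle) :
    (volume.restrict (Set.Ico (0 : ℝ) 1)) (X ⁻¹' {a}) = 0 := by
  have hbound : ∀ k : ℕ, m.natAbs ≤ k →
      (volume.restrict (Set.Ico (0 : ℝ) 1)) (X ⁻¹' {a}) ≤ ENNReal.ofReal (1 / (k + 1)) := by
    intro k hk
    rcases (X ⁻¹' {a}).eq_empty_or_nonempty with h | ⟨ω₀, h₀⟩
    · simp [h]
    have hN : 0 < (st (k + 1)).N := (Nat.zero_le k).trans_lt (hgood k).lt_N
    refine (measure_mono ?_).trans ((volume_floor_mul_fract_eq_le hN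
      ⌊(st (k + 1)).N * Int.fract ω₀⌋₊).trans (ENNReal.ofReal_le_ofReal ?_))
    · intro ω hω
      by_contra hne
      have h1 := (hgood k).separated m (Finset.mem_Icc.2 (by omega)) _
        (Finset.mem_range.2 (floor_mul_fract_lt hN ω)) _
        (Finset.mem_range.2 (floor_mul_fract_lt hN ω₀)) hne
      have h2 := hX k ω
      have h3 := hX k ω₀
      rw [Set.mem_preimage, Set.mem_singleton_iff] at hω h₀
      rw [hω, dist_comm] at h2
      rw [h₀] at h3
      linarith [dist_triangle ((st (k + 1)).F m ⌊(st (k + 1)).N * Int.fract ω⌋₊) a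
        ((st (k + 1)).F m ⌊(st (k + 1)).N * Int.fract ω₀⌋₊)]
    · gcongr
      exact_mod_cast (hgood k).lt_N
  refine le_antisymm (ge_of_tendsto (x := atTop) ?_ (eventually_atTop.2 ⟨m.natAbs, hbound⟩)) zero_le
  rw [← ENNReal.ofReal_zero]
  exact ENNReal.tendsto_ofReal tendsto_one_div_add_atTop_nhds_zero_nat

/-- For a return time of stage `k`, the integrand is at most `1 / (k + 1)` outside a set of measure
`1 / (k + 1)`, and at most `2` there. -/
theorem Stage.integral_limit_le {S : Set ℤ} {st : Stage} {k : ℕ} (hgood : Stage.IsGood.{v} S k st)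
    {m : ℤ} (hm : m.natAbs ≤ k) {X : ℝ → UnitAddCircle} (hXm : Measurable X)
    (hX : ∀ ω, dist (X ω) (st.F m ⌊st.N * Int.fract ω⌋₊) ≤ 2 * st.e) {s : ℤ} (hs : s ∈ st.R) :
    ∫ x, ‖(AddCircle.toCircle ((s - m) • x) : ℂ) - 1‖
      ∂((volume.restrict (Set.Ico (0 : ℝ) 1)).map X) ≤ 3 * (1 / (k + 1)) := by
  have hmI : m ∈ Finset.Icc (-k : ℤ) k := Finset.mem_Icc.2 (by omega)
  have hN : 0 < st.N := (Nat.zero_le k).trans_lt hgood.lt_N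
  have hN' : (0 : ℝ) < st.N := by exact_mod_cast hN
  set P := volume.restrict (Set.Ico (0 : ℝ) 1) with hP
  have : IsProbabilityMeasure P := ⟨by simp [hP]⟩
  let g : UnitAddCircle → ℝ := fun x => ‖(AddCircle.toCircle ((s - m) • x) : ℂ) - 1‖
  have hg : Continuous g :=
    ((continuous_subtype_val.comp
      (AddCircle.continuous_toCircle.comp (continuous_zsmul _))).sub continuous_const).norm
  have hg2 : ∀ x, g x ≤ 2 := fun x => (norm_sub_le _ _).trans (by
    rw [Circle.norm_coe, norm_one]; norm_num)
  let J := (Finset.range st.N).filter fun j => (s - m) • st.F m j ≠ 0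
  let B : Set ℝ := {ω | ⌊st.N * Int.fract ω⌋₊ ∈ J}
  have hB : MeasurableSet B :=
    (Nat.measurable_floor.comp (measurable_fract.const_mul _)) (MeasurableSpace.measurableSet_top)
  have hPB : P.real B ≤ 1 / (k + 1) := by
    refine ENNReal.toReal_le_of_le_ofReal (by positivity)
      ((volume_floor_mul_fract_mem_le hN J).trans (ENNReal.ofReal_le_ofReal ?_))
    rw [div_le_div_iff₀ hN' (by positivity), one_mul]
    exact_mod_cast hgood.card_le m hmI s hs
  have hle : ∀ ω, g (X ω) ≤ 1 / (k + 1) + B.indicator (fun _ => 2) ω := by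
    intro ω
    by_cases hω : ω ∈ B
    · rw [Set.indicator_of_mem hω]
      linarith [hg2 (X ω), (by positivity : (0 : ℝ) ≤ 1 / (k + 1))]
    · rw [Set.indicator_of_notMem hω, add_zero]
      have h0 : (s - m) • st.F m ⌊st.N * Int.fract ω⌋₊ = 0 := by
        by_contra h
        exact hω (Finset.mem_filter.2 ⟨Finset.mem_range.2 (floor_mul_fract_lt hN ω), h⟩)
      have h1 := hgood.near m hmI s hs (X ω - st.F m ⌊st.N * Int.fract ω⌋₊) (by
        rw [← dist_eq_norm]; exact hX ω)
      rwa [smul_sub, h0, sub_zero] at h1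
  have hint : Integrable (fun ω => (1 / (k + 1) : ℝ) + B.indicator (fun _ => (2 : ℝ)) ω) P :=
    (integrable_const _).add ((integrable_const _).indicator hB)
  rw [integral_map hXm.aemeasurable hg.aestronglyMeasurable]
  calc ∫ ω, g (X ω) ∂P ≤ ∫ ω, ((1 / (k + 1) : ℝ) + B.indicator (fun _ => (2 : ℝ)) ω) ∂P :=
        integral_mono_of_nonneg (Eventually.of_forall fun ω => norm_nonneg _) hint
          (Eventually.of_forall hle)
    _ = 1 / (k + 1) + P.real B * 2 := by
        rw [integral_add (integrable_const _) ((integrable_const _).indicator hB),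
          integral_indicator_const _ hB]
        simp
    _ ≤ _ := by linarith

/-! ### Conclusion -/

theorem IsRecurrentAt.nonempty {S : Set ℤ} {δ : ENNReal} (h : IsRecurrentAt.{u} S δ)
    (hδ : δ ≤ 1) : S.Nonempty := by
  obtain ⟨n, hn, -⟩ := h PUnit (Measure.dirac PUnit.unit) (MeasurableEquiv.refl _)
    (MeasurePreserving.id _) Set.univ MeasurableSet.univ (by simpa using hδ)
  exact ⟨n, hn⟩

/-- A union of nonempty finite blocks is enumerated by a sequence that visits each block only
finitely often. -/
theorem exists_enumeration_blocks (R : ℕ → Finset ℤ) (hR : ∀ k, (R k).Nonempty) :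
    ∃ (s : ℕ → ℤ) (b : ℕ → ℕ), (∀ n, s n ∈ R (b n)) ∧ (∀ k, ∀ x ∈ R k, x ∈ Set.range s) ∧
      Tendsto b atTop atTop := by
  have : Infinite (Σ k, R k) := Infinite.of_injective
    (fun k => (⟨k, ⟨(hR k).choose, (hR k).choose_spec⟩⟩ : Σ k, R k))
    fun i j h => congrArg Sigma.fst h
  obtain ⟨_⟩ := nonempty_denumerable (Σ k, R k)
  let g := (Denumerable.eqv (Σ k, R k)).symm
  refine ⟨fun n => (g n).2, fun n => (g n).1, fun n => (g n).2.2, fun k x hx =>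
    ⟨g.symm ⟨k, x, hx⟩,
      congrArg (fun p : Σ k, R k => (p.2 : ℤ)) (g.apply_symm_apply _)⟩, ?_⟩
  refine tendsto_atTop.2 fun K => ?_
  rw [← Nat.cofinite_eq_atTop]
  have hfin : {p : Σ k, R k | p.1 < K}.Finite := by
    refine ((Set.finite_Iio K).biUnion
      fun k _ => Set.finite_range fun x : R k => (⟨k, x⟩ : Σ k, R k)).subset ?_
    rintro ⟨k, x⟩ hp
    exact Set.mem_biUnion (show k ∈ Set.Iio K from hp) ⟨x, rfl⟩
  refine ((hfin.preimage g.injective.injOn).subset ?_)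
  intro n hn
  change ¬ K ≤ (g n).1 at hn
  exact not_le.1 hn

theorem proposition1p6 (S : Set ℤ) (hS : IsMeasureExpanding.{u} S) :
    ∃ (s' : ℕ → ℤ) (σ : ℤ → Measure UnitAddCircle),
      (∀ n, s' n ∈ S) ∧
      (∀ m, IsProbabilityMeasure (σ m) ∧ ∀ a : UnitAddCircle, σ m {a} = 0) ∧
      IsMeasureExpanding.{v} (Set.range s') ∧
      ∀ m : ℤ, Tendsto
        (fun n : ℕ => ∫ x, ‖(AddCircle.toCircle ((s' n - m) • x) : ℂ) - 1‖ ∂(σ m))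
        atTop (𝓝 0) := by
  choose next hnext using fun k (st : {st : Stage // 0 < st.N ∧ 0 < st.e}) =>
    Stage.exists_refines_isGood.{u, v} hS k st.1 st.2.1 st.2.2
  -- Stage `0` is an arbitrary start; `st (k + 1)` is good for `k`.
  let seq : ℕ → {st : Stage // 0 < st.N ∧ 0 < st.e} := fun k =>
    Nat.rec ⟨⟨1, fun _ _ => 0, ∅, 1⟩, one_pos, one_pos⟩
      (fun k st => ⟨next k st, (hnext k st).1.N_pos, (hnext k st).1.e_pos⟩) k
  let st : ℕ → Stage := fun k => (seq k).1
  have hst : ∀ k, (st k).Refines (st (k + 1)) := fun k => (hnext k (seq k)).1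
  have hgood : ∀ k, Stage.IsGood.{v} S k (st (k + 1)) := fun k => (hnext k (seq k)).2
  have hδ1 : ∀ k : ℕ, ENNReal.ofReal (1 / (k + 1)) ≤ 1 := fun k => by
    rw [ENNReal.ofReal_le_one, div_le_one (by positivity)]
    linarith [(Nat.cast_nonneg k : (0 : ℝ) ≤ k)]
  obtain ⟨s', b, hs', hrange, hb⟩ := exists_enumeration_blocks (fun k => (st (k + 1)).R) fun k => by
    have h := ((hgood k).recurrent 0 (Finset.mem_Icc.2 (by omega))).nonempty (hδ1 k)
    exact Finset.coe_nonempty.1 (Set.image_nonempty.1 h)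
  choose X hXm hX using Stage.exists_limit hst
  refine ⟨s', fun m => (volume.restrict (Set.Ico (0 : ℝ) 1)).map (X m),
    fun n => (hgood _).subset (hs' n), fun m => ⟨?_, fun a => ?_⟩, ?_, fun m => ?_⟩
  · have : IsProbabilityMeasure (volume.restrict (Set.Ico (0 : ℝ) 1)) := ⟨by simp⟩
    exact Measure.isProbabilityMeasure_map (hXm m).aemeasurable
  · rw [Measure.map_apply (hXm m) (measurableSet_singleton a)]
    exact Stage.limit_fibre_null hgood (hX m) a
  · intro m Y _ μ _ T hT D hD hμ
    have h0 : Tendsto (fun k : ℕ => ENNReal.ofReal (1 / (k + 1))) atTop (𝓝 0) := by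
      rw [← ENNReal.ofReal_zero]
      exact ENNReal.tendsto_ofReal tendsto_one_div_add_atTop_nhds_zero_nat
    obtain ⟨k, hk, hkm⟩ := ((h0.eventually_lt_const hμ).and (eventually_ge_atTop m.natAbs)).exists
    obtain ⟨_, ⟨s, hs, rfl⟩, hpos⟩ :=
      (hgood k).recurrent m (Finset.mem_Icc.2 (by omega)) Y μ T hT D hD hk.le
    exact ⟨s + m, ⟨s, hrange k s hs, rfl⟩, hpos⟩
  · have h0 : Tendsto (fun n => 3 * (1 / ((b n : ℝ) + 1))) atTop (𝓝 0) := by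
      have := (tendsto_one_div_add_atTop_nhds_zero_nat (𝕜 := ℝ)).comp hb
      simpa using this.const_mul 3
    refine squeeze_zero' (Eventually.of_forall fun n => integral_nonneg fun x => norm_nonneg _) ?_ h0
    filter_upwards [hb.eventually_ge_atTop m.natAbs] with n hn
    exact Stage.integral_limit_le (hgood (b n)) hn (hXm m) (hX m (b n)) (hs' n)
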